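/- Conventions. Local rings are Noetherian; $\ell$ denotes length of modules. For $\mathbf a\in\mathbb R^d$ such that $\mathbf u\mapsto\langle\mathbf a,\mathbf u\rangle$ is injective on $\mathbb Z^d$, order $\mathbb Z^d$ by $\mathbf u\le\mathbf v\iff\langle\mathbf a,\mathbf u\rangle\le\langle\mathbf a,\mathbf v\rangle$. A valuation on a field $\mathbb F$ with value group $\mathbb Z^d$ (with respect to this order) is a surjective group homomorphism $\nu:\mathbb F^\times\to\mathbb Z^d$ with $\nu(x+y)\ge\min\{\nu(x),\nu(y)\}$ whenever $x,y,x+y\neq0$. Put $\mathbb F_{\ge\mathbf u}=\{0\}\cup\{x\in\mathbb F^\times:\nu(x)\ge\mathbf u\}$, and let $V=\mathbb F_{\ge\mathbf 0}$ be the valuation ring, with residue field $\Bbbk_V$. A local domain $(D,\mathfrak m,\Bbbk)$ of dimension $d$ with fraction field $\mathbb F$ is called an OK domain if there are such an $\mathbf a\in\mathbb R^d$ and a valuation $\nu$ on $\mathbb F$ with value group $\mathbb Z^d$ such that 1. $D\subseteq V$ and the inclusion is a local homomorphism; 2. $\langle\mathbf a,\mathbf u\rangle>0$ for every nonzero $\mathbf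 u$ in the closed convex cone in $\mathbb R^d$ generated by $\nu(D\setminus\{0\})$; 3. the induced extension of residue fields $\Bbbk\hookrightarrow\Bbbk_V$ is finite; 4. there is $\mathbf v\in\mathbb Z^d$ such that $D\cap\mathbb F_{\ge n\mathbf v}\subseteq\mathfrak m^n$ for every integer $n\ge0$. In a ring of prime characteristic $p$, a $p$-family of ideals is a sequence of ideals $I_\bullet=\{I_q\}$, indexed by the powers $q=p^e$, $e\ge0$, of $p$, such that $I_q^{[p]}\subseteq I_{pq}$ for all $q$, where $I^{[p]}$ is the ideal generated by the $p$-th powers of the elements of $I$. Theorem. Let $(R,\mathfrak m)$ be a reduced local ring of prime characteristic $p>0$ and Krull dimension $d$ such that the quotient of $R$ by each minimal prime is an OK domain. Let $I_\bullet$ and $J_\bullet$ be $p$-families of ideals of $R$ with $I_q\subseteq J_q$ for all $q$. If there is a positive integer $c$ such that $\mathfrak m^{cq}\cap I_q=\mathfrak m^{cq}\cap J_q$ for all $q=p^e$, then $\ell_R(J_q/I_q)$ is finite for every $q$, and the limit $$\lim_{q\to\infty}\frac{\ell_R(J_q/I_q)}{q^d}$$ (over the powers $q=p^e$ of $p$)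 exists as a real number. -/

import Mathlib

open Filter Topology

/-- A lattice point of `ℤ^d`, regarded as a point of `ℝ^d`. -/
def latticeToReal {d : ℕ} (u : Fin d → ℤ) : Fin d → ℝ := fun i => (u i : ℝ)

/-- A valuation on the field `F` with value group `ℤ^d`. The vector `a` determines the
`ℤ`-linear embedding `u ↦ ⟨a, u⟩` of `ℤ^d` into `ℝ`, and `ℤ^d` is ordered through that embedding.
(`Multiplicative` only turns the additive group `ℤ^d` into a multiplicative one.) -/
structure LatticeValuation (F : Type*) [Field F] (d : ℕ) where
  /-- the vector inducing the embedding of `ℤ^d` into `ℝ` -/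
  a : Fin d → ℝ
  /-- the map `u ↦ ⟨a, u⟩` is an embedding of `ℤ^d` into `ℝ` -/
  embedding_injective : Function.Injective fun u : Fin d → ℤ => dotProduct a (latticeToReal u)
  /-- the valuation as a group homomorphism on the nonzero elements -/
  toHom : Fˣ →* Multiplicative (Fin d → ℤ)
  toHom_surjective : Function.Surjective toHom
  /-- `ν (x + y) ≥ min (ν x) (ν y)` whenever `x`, `y` and `x + y` are nonzero -/
  min_le_add : ∀ x y z : Fˣ, (x : F) + (y : F) = (z : F) →
    min (dotProduct a (latticeToReal (toHom x).toAdd))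
        (dotProduct a (latticeToReal (toHom y).toAdd)) ≤
      dotProduct a (latticeToReal (toHom z).toAdd)

namespace LatticeValuation

variable {F : Type*} [Field F] {d : ℕ} (ν : LatticeValuation F d)

/-- The image in `ℝ` of a lattice point under the embedding attached to `ν`. -/
def embed (u : Fin d → ℤ) : ℝ := dotProduct ν.a (latticeToReal u)

/-- The value `ν(x)` in `ℤ^d` of a nonzero element. -/
def val (x : Fˣ) : Fin d → ℤ := (ν.toHom x).toAdd

/-- The set `F_{≥ u}`, consisting of `0` and of all nonzero `x` with `ν(x) ≥ u`. -/
def geSet (u : Fin d → ℤ) : Set F :=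
  {x | ∀ y : Fˣ, (y : F) = x → ν.embed u ≤ ν.embed (ν.val y)}

theorem embed_zero : ν.embed 0 = 0 := by
  simp [embed, latticeToReal, dotProduct]

theorem embed_add (u v : Fin d → ℤ) : ν.embed (u + v) = ν.embed u + ν.embed v := by
  simp [embed, latticeToReal, dotProduct, mul_add, Finset.sum_add_distrib]

theorem val_mul (x y : Fˣ) : ν.val (x * y) = ν.val x + ν.val y := by
  simp [val]

theorem val_one : ν.val 1 = 0 := by
  simp [val]

theorem embed_val_inv (x : Fˣ) : ν.embed (ν.val x⁻¹) = - ν.embed (ν.val x) := by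
  have h : ν.embed (ν.val (x * x⁻¹)) = 0 := by rw [mul_inv_cancel, val_one, embed_zero]
  rw [val_mul, embed_add] at h
  linarith

theorem embed_val_neg (x : Fˣ) : ν.embed (ν.val (-x)) = ν.embed (ν.val x) := by
  have h : ν.embed (ν.val (-x * -x)) = ν.embed (ν.val (x * x)) := by rw [neg_mul_neg]
  rw [val_mul, embed_add, val_mul, embed_add] at h
  linarith

/-- The valuation ring `V = F_{≥ 0}` of `ν`. -/
def ring : ValuationSubring F where
  carrier := ν.geSet 0
  mul_mem' := by
    intro x y hx hy z hz
    have hx0 : x ≠ 0 := by rintro rfl; simp at hz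
    have hy0 : y ≠ 0 := by rintro rfl; simp at hz
    have h : z = Units.mk0 x hx0 * Units.mk0 y hy0 := by ext; simpa using hz
    have h1 := hx (Units.mk0 x hx0) rfl
    have h2 := hy (Units.mk0 y hy0) rfl
    rw [h, val_mul, embed_add]
    rw [embed_zero] at *
    linarith
  one_mem' := by
    intro y hy
    have h : y = 1 := by ext; simpa using hy
    rw [h, val_one]
  add_mem' := by
    intro x y hx hy z hz
    by_cases hx0 : x = 0
    · exact hy z (by simpa [hx0] using hz)
    by_cases hy0 : y = 0
    · exact hx z (by simpa [hy0] using hz)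
    exact le_trans (le_min (hx (Units.mk0 x hx0) rfl) (hy (Units.mk0 y hy0) rfl))
      (ν.min_le_add (Units.mk0 x hx0) (Units.mk0 y hy0) z (by simpa using hz.symm))
  zero_mem' := by
    intro y hy
    simp at hy
  neg_mem' := by
    intro x hx z hz
    have h := hx (-z) (by simp [hz])
    rwa [embed_val_neg] at h
  mem_or_inv_mem' := by
    intro x
    by_cases hx0 : x = 0
    · left
      intro y hy
      simp [hx0] at hy
    rcases le_total 0 (ν.embed (ν.val (Units.mk0 x hx0))) with h | h
    · left
      intro y hy
      have e : y = Units.mk0 x hx0 := by ext; simpa using hy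
      rw [e, embed_zero]
      exact h
    · right
      intro y hy
      have e : y = (Units.mk0 x hx0)⁻¹ := by ext; simpa using hy
      rw [e, embed_zero, embed_val_inv]
      linarith

section Relative

variable (D : Type*) [CommRing D] [Algebra D F]

/-- The semigroup `ν(D)` in `ℤ^d` of values of the nonzero elements of `D`. -/
def valueSemigroup : Set (Fin d → ℤ) :=
  {u | ∃ (x : D) (y : Fˣ), (y : F) = algebraMap D F x ∧ ν.val y = u}

/-- The closed cone in `ℝ^d` generated by `ν(D)`: the closure of the set of all linear combinations
with nonnegative coefficients of elements of `ν(D)`. -/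
def valueCone : Set (Fin d → ℝ) :=
  closure (PointedCone.hull ℝ (latticeToReal '' ν.valueSemigroup D) : Set (Fin d → ℝ))

/-- When the image of `D` in `F` lies in the valuation ring `V` of `ν`, the resulting ring
homomorphism `D → V`. -/
def toRing (h : ∀ x : D, algebraMap D F x ∈ ν.ring) : D →+* ν.ring :=
  (algebraMap D F).codRestrict ν.ring.toSubring h

/-- `ν` is OK relative to the local domain `D` (with fraction field `F`). -/
structure IsOK [IsLocalRing D] : Prop where
  /-- `D` is contained in the valuation ring `V` -/
  mem_ring : ∀ x : D, algebraMap D F x ∈ ν.ring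
  /-- the inclusion of `D` in `V` is local; so `ν` dominates `D` -/
  isLocalHom : IsLocalHom (ν.toRing D mem_ring)
  /-- the domination is strong: the closed cone generated by `ν(D)`, and not only `ν(D)` itself,
  is pointed by the order on `ℤ^d` -/
  pointed : ∀ u ∈ ν.valueCone D, u ≠ 0 → 0 < dotProduct ν.a u
  /-- the residue field of `V` is a finite extension of the residue field of `D` -/
  finite_residue : (IsLocalRing.ResidueField.map (ν.toRing D mem_ring)).Finite
  /-- there is `v` in `ℤ^d` such that `D ∩ F_{≥ n v} ⊆ 𝔪^n` for every nonnegative integer `n` -/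
  exists_bound : ∃ v : Fin d → ℤ, ∀ (n : ℕ) (x : D),
    algebraMap D F x ∈ ν.geSet (n • v) → x ∈ IsLocalRing.maximalIdeal D ^ n

end Relative

end LatticeValuation

/-- An OK domain: a Noetherian local domain of some dimension `d` whose fraction field carries a
valuation with value group `ℤ^d` that is OK relative to the domain. -/
def IsOKDomain (D : Type*) [CommRing D] : Prop :=
  ∃ (_ : IsDomain D) (_ : IsLocalRing D) (_ : IsNoetherianRing D) (d : ℕ)
    (_ : ringKrullDim D = d) (ν : LatticeValuation (FractionRing D) d), ν.IsOK D

/-- The Frobenius power `I^[p]`: the ideal generated by the `p`-th powers of the elements of `I`. -/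
def Ideal.frobeniusPow {R : Type*} [CommRing R] (p : ℕ) (I : Ideal R) : Ideal R :=
  Ideal.span ((fun x : R => x ^ p) '' (I : Set R))

/-- A `p`-family of ideals, as a sequence indexed by the exponent: the ideal with index `e` is
`I_q` for `q = p ^ e`. -/
def IsPFamily {R : Type*} [CommRing R] (p : ℕ) (I : ℕ → Ideal R) : Prop :=
  ∀ e : ℕ, (I e).frobeniusPow p ≤ I (e + 1)

/-- The length of the `R`-module `J / I`, for ideals `I ⊆ J` of `R`. -/
noncomputable def quotientLength {R : Type*} [CommRing R] (J I : Ideal R) : ℕ∞ :=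
  Module.length R (J ⧸ Submodule.submoduleOf I J)

/-! The problem is reduced to counting lattice points. By the modular law, `J_q/I_q` has the same
length as `(J_q + 𝔪^{cq})/(I_q + 𝔪^{cq})`, a difference of two colengths, so only `p`-families `A_q`
containing `𝔪^{cq}` matter (`quotientLength_sup_sup`). As `R` is reduced, its minimal primes meet in
`0`. Adding these primes one at a time splits the colength of `A_q` into lengths of `KD/(A_q ∩ K)D`,
with `D = R/P` an OK domain and `K` the intersection of the primes already used. Artin–Rees shows
that `(A_q ∩ K)D` contains `KD ∩ 𝔪_D^{c'q}` for some `c'` (`exists_tendsto_quotientLength_inf`).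

In an OK domain, condition 4 makes the two families agree at valuation level at least `qα`, so the
length is again a difference, now of lengths of `M_q` modulo its elements of level at least `qα`.
The graded pieces of the valuation filtration of `M_q` embed in the residue field of `V`, which has
finite length `κ` over `D`. They vanish off `ν(M_q)` and have full length on a fixed translate of
it. Hence the length is `κ` times the number of values of `M_q` below `qα`, up to a bounded shift of
the level (`IsOK.exists_length_bounds`).

That number, divided by `q^d`, converges because it is bounded and almost increasing: a value of
`M_q` yields a box of `m^d` values of `M_{mq}` for `m = p^k`, and the loss is a slab of bounded
width containing only `o(q^d)` points (`IsFullMonoid.exists_tendsto_countBelow`). -/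

theorem exists_tendsto_of_le_add {f ε : ℕ → ℝ} {B : ℝ} (hB : ∀ e, f e ≤ B)
    (hε : Tendsto ε atTop (𝓝 0)) (h : ∀ e k, f e - ε e ≤ f (e + k)) :
    ∃ L, Tendsto f atTop (𝓝 L) := by
  have hbdd : BddAbove (Set.range fun e => f e - ε e) :=
    ⟨B, by rintro _ ⟨e, rfl⟩; exact (h e 0).trans (hB _)⟩
  -- Every term `f e - ε e` bounds all later values of `f` from below, while `f e` exceeds the
  -- supremum by at most `ε e`.
  refine ⟨⨆ e, (f e - ε e), ?_⟩
  rw [tendsto_order]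
  constructor
  · intro b hb
    obtain ⟨e, he⟩ := exists_lt_of_lt_ciSup hb
    filter_upwards [eventually_ge_atTop e] with n hn
    obtain ⟨k, rfl⟩ := Nat.exists_eq_add_of_le hn
    exact he.trans_le (h e k)
  · intro b hb
    filter_upwards [hε.eventually (gt_mem_nhds (sub_pos.2 hb))] with n hn
    have := le_ciSup hbdd n
    linarith

/-! ### Counting lattice points in ideals of a monoid -/

section LatticeCount

variable {d : ℕ} (φ : (Fin d → ℤ) →+ ℝ)

theorem map_nsmul_eq_mul (n : ℕ) (u : Fin d → ℤ) : φ (n • u) = n * φ u := by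
  rw [map_nsmul, nsmul_eq_mul]

/-- The number of points of `T` on which `φ` is less than `t`. -/
noncomputable def countBelow (T : Set (Fin d → ℤ)) (t : ℝ) : ℕ := {u ∈ T | φ u < t}.ncard

/-- The submonoid `S` generates `ℤ^d` as a group, `φ` is nonnegative on `S`, and the number of
points of `S` below a given level is finite and grows at most like the `d`-th power of the level. -/
structure IsFullMonoid (S : AddSubmonoid (Fin d → ℤ)) : Prop where
  nonneg : ∀ s ∈ S, 0 ≤ φ s
  exists_sub : ∀ u, ∃ s ∈ S, ∃ t ∈ S, u = s - t
  finite : ∀ t : ℝ, {u ∈ (S : Set (Fin d → ℤ)) | φ u < t}.Finite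
  exists_le : ∃ C : ℝ, ∀ t : ℝ, 1 ≤ t → (countBelow φ S t : ℝ) ≤ C * t ^ d

variable {φ} {S : AddSubmonoid (Fin d → ℤ)}


theorem IsFullMonoid.finite_of_subset (hS : IsFullMonoid φ S) {T : Set (Fin d → ℤ)} (hT : T ⊆ S) (t : ℝ) :
    {u ∈ T | φ u < t}.Finite :=
  (hS.finite t).subset fun _ hu => ⟨hT hu.1, hu.2⟩

/-- The slab has width `φ s`, so its translates by `0, s, …, (M - 1)s` are pairwise disjoint; all
lie in `S` below the larger level. -/
theorem IsFullMonoid.card_slab_mul_le (hS : IsFullMonoid φ S) {s : Fin d → ℤ} (hs : s ∈ S) (t : ℝ) (M : ℕ) :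
    M * {u ∈ (S : Set (Fin d → ℤ)) | t - φ s ≤ φ u ∧ φ u < t}.ncard ≤
      countBelow φ S (t + M * φ s) := by
  have h0 := hS.nonneg s hs
  set Z := {u ∈ (S : Set (Fin d → ℤ)) | t - φ s ≤ φ u ∧ φ u < t}
  have hinj : Set.InjOn (fun x : ℕ × (Fin d → ℤ) => x.2 + x.1 • s)
      ((Finset.range M : Set ℕ) ×ˢ Z) := by
    have key : ∀ i j : ℕ, ∀ u ∈ Z, ∀ v ∈ Z, u + i • s = v + j • s → i ≤ j := by
      intro i j u hu v hv h
      by_contra! hij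
      have h1 := congrArg φ h
      simp only [map_add, map_nsmul_eq_mul] at h1
      have h2 : (j : ℝ) + 1 ≤ i := by exact_mod_cast hij
      nlinarith [hu.2.1, hv.2.2, mul_le_mul_of_nonneg_right h2 h0]
    rintro ⟨i, u⟩ ⟨-, hu⟩ ⟨j, v⟩ ⟨-, hv⟩ h
    have hij : i = j := le_antisymm (key i j u hu v hv h) (key j i v hv u hu h.symm)
    subst hij
    simpa using h
  have hmaps : (fun x : ℕ × (Fin d → ℤ) => x.2 + x.1 • s) '' ((Finset.range M : Set ℕ) ×ˢ Z) ⊆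
      {u ∈ (S : Set (Fin d → ℤ)) | φ u < t + M * φ s} := by
    rintro _ ⟨⟨i, u⟩, ⟨hi, hu⟩, rfl⟩
    refine ⟨S.add_mem hu.1 (S.nsmul_mem hs _), ?_⟩
    have h2 : (i : ℝ) ≤ M := by exact_mod_cast (by simpa using hi : i < M).le
    simp only [map_add, map_nsmul_eq_mul]
    nlinarith [hu.2.2, mul_le_mul_of_nonneg_right h2 h0]
  have := Set.ncard_le_ncard hmaps (hS.finite _)
  rw [hinj.ncard_image, Set.ncard_prod, Set.ncard_coe_finset, Finset.card_range] at this
  exact this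

theorem IsFullMonoid.countBelow_mono (hS : IsFullMonoid φ S) {T : Set (Fin d → ℤ)} (hT : T ⊆ S) {t t' : ℝ} (h : t ≤ t') :
    countBelow φ T t ≤ countBelow φ T t' :=
  Set.ncard_le_ncard (fun _ hu => ⟨hu.1, hu.2.trans_le h⟩) (hS.finite_of_subset hT _)

theorem IsFullMonoid.countBelow_le_add (hS : IsFullMonoid φ S) {T : Set (Fin d → ℤ)} (hT : T ⊆ S) (t K : ℝ) :
    countBelow φ T t ≤ countBelow φ T (t - K) +
      {u ∈ (S : Set (Fin d → ℤ)) | t - K ≤ φ u ∧ φ u < t}.ncard := by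
  refine (Set.ncard_le_ncard ?_ ((hS.finite_of_subset hT _).union
    ((hS.finite t).subset fun u hu => ⟨hu.1, hu.2.2⟩))).trans (Set.ncard_union_le _ _)
  intro u hu
  rcases lt_or_ge (φ u) (t - K) with h | h
  · exact Or.inl ⟨hu.1, h⟩
  · exact Or.inr ⟨hT hu.1, h, hu.2⟩

/-- With `q = p^e` and `s ∈ S` such that `φ s ≥ K`, the `q` disjoint translates of a slab of width
`φ s` fit below `q(α + φ s)`. The growth bound then leaves at most `C(α + φ s)^d q^{d-1}` points in
one slab. -/
theorem IsFullMonoid.tendsto_card_slab (hS : IsFullMonoid φ S) {p : ℕ} (hp : 1 < p) {α : ℝ} (hα : 1 ≤ α) (K : ℝ) :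
    Tendsto (fun e : ℕ => (({u ∈ (S : Set (Fin d → ℤ)) |
      (p : ℝ) ^ e * α - K ≤ φ u ∧ φ u < (p : ℝ) ^ e * α}.ncard : ℕ) : ℝ) / ((p : ℝ) ^ e) ^ d)
      atTop (𝓝 0) := by
  have hp' : (1 : ℝ) < p := by exact_mod_cast hp
  have hpinf := tendsto_pow_atTop_atTop_of_one_lt hp'
  by_cases hex : ∃ s ∈ S, 0 < φ s
  · obtain ⟨s₀, hs₀, hpos⟩ := hex
    obtain ⟨n, hn⟩ := Archimedean.arch K hpos
    obtain ⟨s, hs, hKs⟩ : ∃ s ∈ S, K ≤ φ s := ⟨n • s₀, S.nsmul_mem hs₀ _, by rwa [map_nsmul]⟩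
    have h0 := hS.nonneg s hs
    obtain ⟨C, hC⟩ := hS.exists_le
    refine squeeze_zero (g := fun e : ℕ => (C * (α + φ s) ^ d) / (p : ℝ) ^ e)
      (fun e => by positivity) (fun e => ?_) (hpinf.const_div_atTop _)
    have hq : (1 : ℝ) ≤ (p : ℝ) ^ e := one_le_pow₀ hp'.le
    have h1 := hS.card_slab_mul_le hs ((p : ℝ) ^ e * α) (p ^ e)
    have h2 := hC ((p : ℝ) ^ e * α + (p : ℝ) ^ e * φ s) (by nlinarith)
    have h3 : {u ∈ (S : Set (Fin d → ℤ)) | (p : ℝ) ^ e * α - K ≤ φ u ∧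
        φ u < (p : ℝ) ^ e * α}.ncard ≤ {u ∈ (S : Set (Fin d → ℤ)) |
          (p : ℝ) ^ e * α - φ s ≤ φ u ∧ φ u < (p : ℝ) ^ e * α}.ncard :=
      Set.ncard_le_ncard (fun u hu => ⟨hu.1, by linarith [hu.2.1], hu.2.2⟩)
        ((hS.finite _).subset fun u hu => ⟨hu.1, hu.2.2⟩)
    have h4 : (p : ℝ) ^ e * ({u ∈ (S : Set (Fin d → ℤ)) | (p : ℝ) ^ e * α - K ≤ φ u ∧
        φ u < (p : ℝ) ^ e * α}.ncard : ℝ) ≤ C * ((p : ℝ) ^ e * α + (p : ℝ) ^ e * φ s) ^ d := by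
      refine le_trans ?_ h2
      have := (Nat.mul_le_mul_left (p ^ e) h3).trans h1
      push_cast at this
      exact_mod_cast this
    rw [div_le_div_iff₀ (by positivity) (by positivity)]
    calc _ = (p : ℝ) ^ e * ({u ∈ (S : Set (Fin d → ℤ)) | (p : ℝ) ^ e * α - K ≤ φ u ∧
        φ u < (p : ℝ) ^ e * α}.ncard : ℝ) := mul_comm _ _
      _ ≤ _ := h4
      _ = _ := by rw [← mul_add, mul_pow]; ring
  -- Here `φ` vanishes on `S`, so the slab is empty once `qα > K`.
  · push Not at hex
    refine tendsto_const_nhds.congr' ?_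
    filter_upwards [(hpinf.atTop_mul_const (by linarith : 0 < α)).eventually_gt_atTop K] with e he
    rw [show {u ∈ (S : Set (Fin d → ℤ)) | (p : ℝ) ^ e * α - K ≤ φ u ∧
        φ u < (p : ℝ) ^ e * α} = ∅ from ?_]
    · simp
    · rw [Set.eq_empty_iff_forall_notMem]
      rintro u ⟨hu, hu1, -⟩
      linarith [hex u hu]

/-- If `T` and `T'` are ideals of `S` with `m T ⊆ T'`, then each point of `T` gives rise to a box of
`m ^ d` points of `T'`. -/
theorem IsFullMonoid.exists_pow_mul_countBelow_le (hS : IsFullMonoid φ S) : ∃ K : ℝ, 0 ≤ K ∧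
    ∀ (T T' : Set (Fin d → ℤ)) (m : ℕ), 0 < m → T' ⊆ S → (∀ s ∈ S, ∀ u ∈ T', s + u ∈ T') →
      (∀ u ∈ T, m • u ∈ T') → ∀ t : ℝ,
      m ^ d * countBelow φ T (t - K) ≤ countBelow φ T' (m * t) := by
  choose a ha b hb hab using fun i : Fin d => hS.exists_sub (Pi.single i 1)
  have hK : 0 ≤ ∑ i, (φ (a i) + φ (b i)) :=
    Finset.sum_nonneg fun i _ => add_nonneg (hS.nonneg _ (ha i)) (hS.nonneg _ (hb i))
  refine ⟨_, hK, fun T T' m hm hT' hideal hmT t => ?_⟩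
  set K := ∑ i, (φ (a i) + φ (b i))
  -- The box attached to `u` is `m(u + ∑ b i) + [0, m)^d`. Residues modulo `m` recover the box
  -- coordinate, whence injectivity. As `a i - b i` is the `i`-th basis vector, the shift by `m ∑ b
  -- i` makes each point `m u` plus an element of `S` of level at most `mK`.
  let g : (Fin d → Fin m) × (Fin d → ℤ) → (Fin d → ℤ) := fun x =>
    m • (x.2 + ∑ i, b i) + fun i => ((x.1 i : ℕ) : ℤ)
  have hg : ∀ x, g x = (∑ i, ((x.1 i : ℕ) • a i + (m - x.1 i : ℕ) • b i)) + m • x.2 := by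
    intro x
    have h1 : (fun i => ((x.1 i : ℕ) : ℤ)) = ∑ i, (x.1 i : ℕ) • (a i - b i) := by
      ext j
      simp only [← hab, Finset.sum_apply, Pi.smul_apply, Pi.single_apply]
      simp
    have h2 : m • ∑ i, b i = ∑ i, ((x.1 i : ℕ) • b i + (m - x.1 i : ℕ) • b i) := by
      rw [Finset.smul_sum]
      refine Finset.sum_congr rfl fun i _ => ?_
      rw [← add_smul, Nat.add_sub_cancel' (x.1 i).2.le]
    simp only [g]
    rw [smul_add, h1, h2, add_assoc, ← Finset.sum_add_distrib, add_comm]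
    congr 1
    refine Finset.sum_congr rfl fun i _ => ?_
    rw [smul_sub]
    abel
  have hinj : Function.Injective g := by
    rintro ⟨x, u⟩ ⟨y, v⟩ h
    have hm0 : (m : ℤ) ≠ 0 := by exact_mod_cast hm.ne'
    have key : ∀ i, x i = y i ∧ u i = v i := by
      intro i
      have hi := congrFun h i
      simp only [g, Pi.add_apply, Pi.smul_apply] at hi
      simp only [nsmul_eq_mul] at hi
      have h1 := congrArg (· % (m : ℤ)) hi
      simp only [Int.mul_add_emod_self_left] at h1
      rw [Int.emod_eq_of_lt (by positivity) (by exact_mod_cast (x i).2),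
        Int.emod_eq_of_lt (by positivity) (by exact_mod_cast (y i).2)] at h1
      refine ⟨Fin.ext (by exact_mod_cast h1), ?_⟩
      rw [h1] at hi
      have := mul_left_cancel₀ hm0 (add_right_cancel hi)
      exact add_right_cancel this
    exact Prod.ext (funext fun i => (key i).1) (funext fun i => (key i).2)
  have hmaps : g '' (Set.univ ×ˢ {u ∈ T | φ u < t - K}) ⊆ {u ∈ T' | φ u < m * t} := by
    rintro _ ⟨⟨x, u⟩, ⟨-, hu, hut⟩, rfl⟩
    simp only at hu hut
    rw [hg]
    refine ⟨hideal _ (S.sum_mem fun i _ => S.add_mem (S.nsmul_mem (ha i) _)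
      (S.nsmul_mem (hb i) _)) _ (hmT u hu), ?_⟩
    have hm' : (0 : ℝ) < m := by exact_mod_cast hm
    have h1 : φ (∑ i, ((x i : ℕ) • a i + (m - x i : ℕ) • b i)) ≤ m * K := by
      rw [map_sum, Finset.mul_sum]
      refine Finset.sum_le_sum fun i _ => ?_
      simp only [map_add, map_nsmul_eq_mul, mul_add]
      refine add_le_add (mul_le_mul_of_nonneg_right ?_ (hS.nonneg _ (ha i)))
        (mul_le_mul_of_nonneg_right ?_ (hS.nonneg _ (hb i)))
      · exact_mod_cast (x i).2.le
      · exact_mod_cast Nat.sub_le _ _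
    rw [map_add, map_nsmul_eq_mul]
    nlinarith [mul_lt_mul_of_pos_left hut hm']
  have := Set.ncard_le_ncard hmaps (hS.finite_of_subset hT' _)
  rw [Set.ncard_image_of_injective _ hinj, Set.ncard_prod, Set.ncard_univ] at this
  simpa [countBelow] using this

/-- A `p`-system of ideals in a monoid has an asymptotic density below a level growing like `q`;
this density is not changed when the level is lowered by a constant. -/
theorem IsFullMonoid.exists_tendsto_countBelow (hS : IsFullMonoid φ S) {p : ℕ} (hp : 1 < p) (T : ℕ → Set (Fin d → ℤ))
    (hTS : ∀ e, T e ⊆ S) (hT : ∀ e, ∀ s ∈ S, ∀ u ∈ T e, s + u ∈ T e)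
    (hpT : ∀ e, ∀ u ∈ T e, p • u ∈ T (e + 1)) {α : ℝ} (hα : 1 ≤ α) :
    ∃ L : ℝ, ∀ K : ℝ, 0 ≤ K → Tendsto (fun e : ℕ =>
      (countBelow φ (T e) ((p : ℝ) ^ e * α - K) : ℝ) / ((p : ℝ) ^ e) ^ d) atTop (𝓝 L) := by
  have hp' : (1 : ℝ) < p := by exact_mod_cast hp
  have hp0 : (0 : ℝ) < p := by linarith
  have hpow : ∀ e k, ∀ u ∈ T e, p ^ k • u ∈ T (e + k) := by
    intro e k u hu
    induction k with
    | zero => simpa using hu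
    | succ k ih =>
      rw [pow_succ', mul_smul]
      exact hpT _ _ ih
  have hslab := fun K => hS.tendsto_card_slab hp hα K
  have hdiff : ∀ (K : ℝ) (e : ℕ), (countBelow φ (T e) ((p : ℝ) ^ e * α) : ℝ) / ((p : ℝ) ^ e) ^ d -
      (({u ∈ (S : Set (Fin d → ℤ)) |
      (p : ℝ) ^ e * α - K ≤ φ u ∧ φ u < (p : ℝ) ^ e * α}.ncard : ℕ) : ℝ) / ((p : ℝ) ^ e) ^ d ≤
      (countBelow φ (T e) ((p : ℝ) ^ e * α - K) : ℝ) / ((p : ℝ) ^ e) ^ d := by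
    intro K e
    rw [← sub_div]
    refine div_le_div_of_nonneg_right ?_ (by positivity)
    have := hS.countBelow_le_add (hTS e) ((p : ℝ) ^ e * α) K
    rw [sub_le_iff_le_add]
    exact_mod_cast this
  obtain ⟨K, hK, hbox⟩ := hS.exists_pow_mul_countBelow_le
  obtain ⟨C, hC⟩ := hS.exists_le
  obtain ⟨L, hL⟩ : ∃ L, Tendsto (fun e : ℕ =>
      (countBelow φ (T e) ((p : ℝ) ^ e * α) : ℝ) / ((p : ℝ) ^ e) ^ d) atTop (𝓝 L) := by
    -- The error term is the normalized slab of width `K`: it pays for lowering the level by `K`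
    -- before the boxes with `m = p^k` are formed.
    refine exists_tendsto_of_le_add (B := C * α ^ d) (fun e => ?_) (hslab K) fun e k => ?_
    · rw [div_le_iff₀ (by positivity)]
      have h1 := hC ((p : ℝ) ^ e * α) (by nlinarith [one_le_pow₀ hp'.le (n := e)])
      have h2 : countBelow φ (T e) ((p : ℝ) ^ e * α) ≤ countBelow φ S ((p : ℝ) ^ e * α) :=
        Set.ncard_le_ncard (fun u hu => ⟨hTS e hu.1, hu.2⟩) (hS.finite _)
      have h3 : (countBelow φ (T e) ((p : ℝ) ^ e * α) : ℝ) ≤ countBelow φ S ((p : ℝ) ^ e * α) := by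
        exact_mod_cast h2
      calc _ ≤ _ := h3.trans h1
        _ = _ := by rw [mul_pow]; ring
    · refine (hdiff K e).trans ?_
      rw [div_le_div_iff₀ (by positivity) (by positivity)]
      have h1 := hbox (T e) (T (e + k)) (p ^ k) (by positivity) (hTS _) (hT _) (hpow e k)
        ((p : ℝ) ^ e * α)
      have h2 : ((p : ℝ) ^ k) ^ d * (countBelow φ (T e) ((p : ℝ) ^ e * α - K) : ℝ) ≤
          countBelow φ (T (e + k)) ((p : ℝ) ^ (e + k) * α) := by
        have h3 : ((p ^ k : ℕ) : ℝ) * ((p : ℝ) ^ e * α) = (p : ℝ) ^ (e + k) * α := by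
          push_cast; ring
        rw [h3] at h1
        exact_mod_cast h1
      calc _ = (((p : ℝ) ^ k) ^ d * (countBelow φ (T e) ((p : ℝ) ^ e * α - K) : ℝ)) *
            ((p : ℝ) ^ e) ^ d := by rw [pow_add, mul_pow]; ring
        _ ≤ _ := mul_le_mul_of_nonneg_right h2 (by positivity)
  refine ⟨L, fun K hK => ?_⟩
  have h1 := hL.sub (hslab K)
  rw [sub_zero] at h1
  refine tendsto_of_tendsto_of_tendsto_of_le_of_le h1 hL (hdiff K) fun e => ?_
  refine div_le_div_of_nonneg_right ?_ (by positivity)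
  exact_mod_cast hS.countBelow_mono (hTS e) (by linarith)

end LatticeCount

/-! ### Lengths of subquotients of ideals -/

section Length

variable {R : Type*} [CommRing R]

theorem quotientLength_le_of_ker {N : Type*} [AddCommGroup N] [Module R N] {A B : Ideal R}
    (f : A →ₗ[R] N) (hker : ∀ x : A, f x = 0 ↔ (x : R) ∈ B) :
    quotientLength A B ≤ Module.length R N := by
  have hk : Submodule.submoduleOf B A = LinearMap.ker f := by
    ext x
    rw [LinearMap.mem_ker, hker]
    rfl
  have hinj : Function.Injective ((Submodule.submoduleOf B A).liftQ f hk.le) := by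
    rw [← LinearMap.ker_eq_bot]
    exact Submodule.ker_liftQ_eq_bot _ _ _ hk.ge
  exact Module.length_le_of_injective _ hinj

theorem quotientLength_eq_of_ker {N : Type*} [AddCommGroup N] [Module R N] {A B : Ideal R}
    (f : A →ₗ[R] N) (hker : ∀ x : A, f x = 0 ↔ (x : R) ∈ B) (hf : Function.Surjective f) :
    quotientLength A B = Module.length R N := by
  refine (quotientLength_le_of_ker f hker).antisymm ?_
  have hk : Submodule.submoduleOf B A ≤ LinearMap.ker f := fun x hx => (hker x).2 hx
  refine Module.length_le_of_surjective ((Submodule.submoduleOf B A).liftQ f hk) ?_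
  rw [← LinearMap.range_eq_top, Submodule.range_liftQ, LinearMap.range_eq_top]
  exact hf

theorem quotientLength_add {A B C : Ideal R} (hCB : C ≤ B) (hBA : B ≤ A) :
    quotientLength A C = quotientLength A B + quotientLength B C := by
  let g : B →ₗ[R] A ⧸ Submodule.submoduleOf C A :=
    (Submodule.submoduleOf C A).mkQ ∘ₗ Submodule.inclusion hBA
  let h : (A ⧸ Submodule.submoduleOf C A) →ₗ[R] A ⧸ Submodule.submoduleOf B A :=
    Submodule.factor (fun x hx => hCB hx)
  have hh : ∀ x, h (Submodule.Quotient.mk x) = Submodule.Quotient.mk x := fun _ => rfl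
  have hrange : LinearMap.range g = LinearMap.ker h := by
    ext x
    obtain ⟨x, rfl⟩ := Submodule.Quotient.mk_surjective _ x
    rw [LinearMap.mem_ker, hh, Submodule.Quotient.mk_eq_zero]
    constructor
    · rintro ⟨y, hy⟩
      have h1 : (Submodule.inclusion hBA y - x : A) ∈ Submodule.submoduleOf C A :=
        (Submodule.Quotient.eq _).1 hy
      have h2 : ((y : R) - x) ∈ C := h1
      have h3 := B.sub_mem y.2 (hCB h2)
      rw [sub_sub_cancel] at h3
      exact h3
    · intro hx
      exact ⟨⟨x, hx⟩, rfl⟩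
  have hBC : quotientLength B C = Module.length R (LinearMap.range g) := by
    refine quotientLength_eq_of_ker g.rangeRestrict (fun x => ?_) g.surjective_rangeRestrict
    rw [← LinearMap.mem_ker, LinearMap.ker_rangeRestrict, LinearMap.mem_ker]
    exact Submodule.Quotient.mk_eq_zero _
  rw [hBC, hrange, add_comm]
  refine Module.length_eq_add_of_exact (LinearMap.ker h).subtype h
    (Submodule.injective_subtype _) ?_ ?_
  · intro x
    obtain ⟨x, rfl⟩ := Submodule.Quotient.mk_surjective _ x
    exact ⟨Submodule.Quotient.mk x, rfl⟩
  · rw [LinearMap.exact_iff, Submodule.range_subtype]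

theorem quotientLength_self (A : Ideal R) : quotientLength A A = 0 := by
  have h := quotientLength_eq_of_ker (A := A) (B := A) (0 : A →ₗ[R] PUnit) (fun x => by simp)
    fun x => ⟨0, rfl⟩
  rw [h, Module.length_eq_zero]

theorem quotientLength_sup (A B : Ideal R) :
    quotientLength (A ⊔ B) B = quotientLength A (A ⊓ B) := by
  let f : A →ₗ[R] (A ⊔ B : Ideal R) ⧸ Submodule.submoduleOf B (A ⊔ B) :=
    Submodule.mkQ _ ∘ₗ Submodule.inclusion le_sup_left
  refine (quotientLength_eq_of_ker f (fun x => ?_) ?_).symm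
  · refine (Submodule.Quotient.mk_eq_zero _).trans ?_
    exact ⟨fun h => ⟨x.2, h⟩, fun h => h.2⟩
  · intro y
    obtain ⟨⟨y, hy⟩, rfl⟩ := Submodule.Quotient.mk_surjective _ y
    obtain ⟨a, ha, b, hb, rfl⟩ := Submodule.mem_sup.1 hy
    refine ⟨⟨a, ha⟩, (Submodule.Quotient.eq _).2 ?_⟩
    show a - (a + b) ∈ B
    simpa using hb

/-- Lengths of subquotients along a surjective ring homomorphism. -/
theorem quotientLength_map {D : Type*} [CommRing D] [Algebra R D]
    (hsurj : Function.Surjective (algebraMap R D)) {K B : Ideal R} (hBK : B ≤ K) :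
    quotientLength (K.map (algebraMap R D)) (B.map (algebraMap R D)) =
      quotientLength K (B ⊔ K ⊓ RingHom.ker (algebraMap R D)) := by
  set K' := K.map (algebraMap R D)
  set B' := B.map (algebraMap R D)
  have h1 : quotientLength K' B' = Module.length R (K' ⧸ Submodule.submoduleOf B' K') :=
    (Module.length_eq_of_surjective hsurj).symm
  let i : K →ₗ[R] K' :=
    { toFun := fun x => ⟨algebraMap R D x, Ideal.mem_map_of_mem _ x.2⟩
      map_add' := fun x y => Subtype.ext (by simp)
      map_smul' := fun r x => Subtype.ext (by simp [Algebra.smul_def]) }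
  let q : K' →ₗ[R] K' ⧸ Submodule.submoduleOf B' K' :=
    (Submodule.mkQ (Submodule.submoduleOf B' K')).restrictScalars R
  rw [h1]
  refine (quotientLength_eq_of_ker (q ∘ₗ i) (fun x => ?_) ?_).symm
  · refine (Submodule.Quotient.mk_eq_zero _).trans ?_
    show algebraMap R D x ∈ B' ↔ _
    rw [Ideal.mem_map_iff_of_surjective _ hsurj]
    constructor
    · rintro ⟨b, hb, hbx⟩
      refine Submodule.mem_sup.2 ⟨b, hb, x - b, ⟨K.sub_mem x.2 (hBK hb), ?_⟩, by ring⟩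
      simp [RingHom.mem_ker, hbx]
    · intro hx
      obtain ⟨b, hb, z, ⟨-, hz⟩, hbz⟩ := Submodule.mem_sup.1 hx
      refine ⟨b, hb, ?_⟩
      rw [← hbz, map_add, (RingHom.mem_ker).1 hz, add_zero]
  · intro y
    obtain ⟨⟨y, hy⟩, rfl⟩ := Submodule.Quotient.mk_surjective _ y
    obtain ⟨x, hx, rfl⟩ := (Ideal.mem_map_iff_of_surjective _ hsurj).1 hy
    exact ⟨⟨x, hx⟩, rfl⟩

end Length

/-! ### Values of ideals and the graded pieces of the valuation filtration -/

namespace LatticeValuation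

variable {F : Type*} [Field F] {d : ℕ} (ν : LatticeValuation F d)

/-- The embedding of `ℤ^d` in `ℝ` attached to `ν`, as an additive homomorphism. -/
def embedHom : (Fin d → ℤ) →+ ℝ where
  toFun := ν.embed
  map_zero' := ν.embed_zero
  map_add' := ν.embed_add

theorem embed_nsmul (n : ℕ) (u : Fin d → ℤ) : ν.embed (n • u) = n * ν.embed u :=
  map_nsmul_eq_mul (φ := ν.embedHom) n u

theorem mem_ring_iff {x : F} : x ∈ ν.ring ↔ ∀ y : Fˣ, (y : F) = x → 0 ≤ ν.embed (ν.val y) := by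
  rw [← ν.embed_zero]
  rfl

theorem mem_maximalIdeal_iff (x : ν.ring) : x ∈ IsLocalRing.maximalIdeal ν.ring ↔
    ∀ y : Fˣ, (y : F) = x → 0 < ν.embed (ν.val y) := by
  rw [IsLocalRing.mem_maximalIdeal, mem_nonunits_iff]
  constructor
  · intro hx y hy
    by_contra! h
    refine hx (IsUnit.of_mul_eq_one ⟨((y⁻¹ : Fˣ) : F), ?_⟩ ?_)
    · rw [mem_ring_iff]
      intro z hz
      rw [Units.ext hz, embed_val_inv]
      linarith
    · ext
      simp [← hy]
  · intro hx hu
    obtain ⟨z, hz⟩ := isUnit_iff_exists_inv.1 hu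
    have hz' : (x : F) * z = 1 := congrArg Subtype.val hz
    let y : Fˣ := ⟨x, z, hz', by rw [mul_comm, hz']⟩
    have h1 := hx y rfl
    have h2 := ν.mem_ring_iff.1 z.2 y⁻¹ rfl
    rw [embed_val_inv] at h2
    linarith

section Relative

variable {D : Type*} [CommRing D] [Algebra D F]

/-- The values of the nonzero elements of an ideal. -/
def valueSet (M : Ideal D) : Set (Fin d → ℤ) :=
  {u | ∃ x ∈ M, ∃ y : Fˣ, (y : F) = algebraMap D F x ∧ ν.val y = u}

variable (D) in
/-- The semigroup `ν(D)` as an additive submonoid. -/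
def valueMonoid : AddSubmonoid (Fin d → ℤ) where
  carrier := ν.valueSemigroup D
  zero_mem' := ⟨1, 1, by simp, ν.val_one⟩
  add_mem' := by
    rintro _ _ ⟨x, y, hy, rfl⟩ ⟨x', y', hy', rfl⟩
    exact ⟨x * x', y * y', by simp [hy, hy'], ν.val_mul _ _⟩

theorem valueSet_subset (M : Ideal D) : ν.valueSet M ⊆ ν.valueMonoid D := by
  rintro u ⟨x, -, h⟩
  exact ⟨x, h⟩

theorem add_mem_valueSet {M : Ideal D} {s u : Fin d → ℤ} (hs : s ∈ ν.valueMonoid D)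
    (hu : u ∈ ν.valueSet M) : s + u ∈ ν.valueSet M := by
  obtain ⟨x, y, hy, rfl⟩ := hs
  obtain ⟨x', hx', y', hy', rfl⟩ := hu
  exact ⟨x * x', M.mul_mem_left _ hx', y * y', by simp [hy, hy'], ν.val_mul _ _⟩

theorem nsmul_mem_valueSet {M N : Ideal D} {n : ℕ} (h : ∀ x ∈ M, x ^ n ∈ N) {u : Fin d → ℤ}
    (hu : u ∈ ν.valueSet M) : n • u ∈ ν.valueSet N := by
  obtain ⟨x, hx, y, hy, rfl⟩ := hu
  exact ⟨x ^ n, h x hx, y ^ n, by simp [hy], by simp [val]⟩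

/-- The ideal of the elements of `D` whose values, if they are nonzero, lie in the upper set `s`. -/
def levelIdeal (hD : ∀ x : D, algebraMap D F x ∈ ν.ring) (s : Set ℝ) (hs : IsUpperSet s) :
    Ideal D where
  carrier := {x | ∀ y : Fˣ, (y : F) = algebraMap D F x → ν.embed (ν.val y) ∈ s}
  zero_mem' := by
    intro y hy
    simp at hy
  add_mem' := by
    intro x x' hx hx' z hz
    by_cases hx0 : algebraMap D F x = 0
    · exact hx' z (by simpa [hx0] using hz)
    by_cases hx0' : algebraMap D F x' = 0
    · exact hx z (by simpa [hx0'] using hz)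
    have h := ν.min_le_add (Units.mk0 _ hx0) (Units.mk0 _ hx0') z (by simpa using hz.symm)
    rcases min_le_iff.1 h with h | h
    · exact hs h (hx (Units.mk0 _ hx0) rfl)
    · exact hs h (hx' (Units.mk0 _ hx0') rfl)
  smul_mem' := by
    intro r x hx z hz
    rw [smul_eq_mul, map_mul] at hz
    have hr0 : algebraMap D F r ≠ 0 := fun h => by simp [h] at hz
    have hx0 : algebraMap D F x ≠ 0 := fun h => by simp [h] at hz
    have h : z = Units.mk0 _ hr0 * Units.mk0 _ hx0 := Units.ext (by simpa using hz)
    rw [h, val_mul, embed_add]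
    have := ν.mem_ring_iff.1 (hD r) (Units.mk0 _ hr0) rfl
    exact hs (by linarith) (hx (Units.mk0 _ hx0) rfl)

theorem mem_levelIdeal {hD : ∀ x : D, algebraMap D F x ∈ ν.ring} {s : Set ℝ} {hs : IsUpperSet s}
    {x : D} : x ∈ ν.levelIdeal hD s hs ↔
      ∀ y : Fˣ, (y : F) = algebraMap D F x → ν.embed (ν.val y) ∈ s := Iff.rfl

section Full

variable [IsLocalRing D] {ν}

/-- Compactness of the unit sphere of the closed value cone turns pointwise positivity of `⟨a, ·⟩`
into a uniform bound. This is where positivity on the closed cone, not merely on `ν(D)`, is needed.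
-/
theorem IsOK.exists_norm_le (h : ν.IsOK D) : ∃ δ : ℝ, 0 < δ ∧
    ∀ u ∈ ν.valueMonoid D, δ * ‖latticeToReal u‖ ≤ ν.embed u := by
  set A : Set (Fin d → ℝ) := ν.valueCone D ∩ Metric.sphere 0 1
  have hA : IsCompact A := (isCompact_sphere _ _).inter_left isClosed_closure
  have hne : ∀ x ∈ A, x ≠ 0 := fun x hx h0 => by simp [A, h0] at hx
  obtain ⟨δ, hδ, hmin⟩ : ∃ δ : ℝ, 0 < δ ∧ ∀ x ∈ A, δ ≤ dotProduct ν.a x := by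
    rcases A.eq_empty_or_nonempty with hA0 | hA0
    · exact ⟨1, one_pos, fun x hx => by simp [hA0] at hx⟩
    · obtain ⟨x, hx, hmin⟩ := hA.exists_isMinOn hA0
        (f := fun x => dotProduct ν.a x) (by unfold dotProduct; fun_prop)
      exact ⟨_, h.pointed x hx.1 (hne x hx), fun y hy => hmin hy⟩
  refine ⟨δ, hδ, fun u hu => ?_⟩
  rcases eq_or_ne (latticeToReal u) 0 with h0 | h0
  · simp [embed, h0]
  · have hpos : 0 < ‖latticeToReal u‖ := norm_pos_iff.2 h0
    have hmem : ‖latticeToReal u‖⁻¹ • latticeToReal u ∈ A := by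
      refine ⟨subset_closure ?_, by simp [norm_smul, hpos.ne']⟩
      exact Submodule.smul_mem _ (⟨‖latticeToReal u‖⁻¹, by positivity⟩ : {c : ℝ // 0 ≤ c})
        (Submodule.subset_span ⟨u, hu, rfl⟩)
    have := hmin _ hmem
    rw [dotProduct_smul, smul_eq_mul, inv_mul_eq_div, le_div_iff₀ hpos] at this
    exact this

/-- The norm bound confines the values below `t` to a cube of half-side `t / δ`, which gives
finiteness and growth. Differences of values exhaust `ℤ^d` because `ν` is surjective and `F`
consists of fractions of `D`. -/
theorem IsOK.isFullMonoid [IsFractionRing D F] (h : ν.IsOK D) : IsFullMonoid ν.embedHom (ν.valueMonoid D) := by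
  obtain ⟨δ, hδ, hnorm⟩ := h.exists_norm_le
  have hsub : ∀ t : ℝ, {u ∈ (ν.valueMonoid D : Set (Fin d → ℤ)) | ν.embedHom u < t} ⊆
      (Fintype.piFinset fun _ : Fin d => Finset.Icc (-(⌊t / δ⌋₊ : ℤ)) ⌊t / δ⌋₊ :
        Finset (Fin d → ℤ)) := by
    rintro t u ⟨hu, hut⟩
    have hut : ν.embed u < t := hut
    rw [Finset.mem_coe, Fintype.mem_piFinset]
    intro i
    have h1 : |(u i : ℝ)| ≤ t / δ := by
      rw [le_div_iff₀ hδ, mul_comm]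
      have h2 : ‖latticeToReal u i‖ ≤ ‖latticeToReal u‖ := norm_le_pi_norm _ i
      exact (mul_le_mul_of_nonneg_left h2 hδ.le).trans ((hnorm u hu).trans hut.le)
    have h3 : (u i).natAbs ≤ ⌊t / δ⌋₊ := by
      refine Nat.le_floor ?_
      rwa [Nat.cast_natAbs, Int.cast_abs]
    rw [Finset.mem_Icc]
    omega
  refine ⟨?_, ?_, fun t => (Finset.finite_toSet _).subset (hsub t), (2 / δ + 1) ^ d, ?_⟩
  · rintro _ ⟨x, y, hy, rfl⟩
    exact ν.mem_ring_iff.1 (h.mem_ring x) y hy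
  · intro u
    obtain ⟨y, hy⟩ := ν.toHom_surjective (Multiplicative.ofAdd u)
    obtain ⟨a, b, hb, hab⟩ := IsFractionRing.div_surjective D (y : F)
    have hb0 : algebraMap D F b ≠ 0 := fun h0 => by simp [h0] at hab; exact y.ne_zero hab.symm
    have ha0 : algebraMap D F a ≠ 0 := fun h0 => by simp [h0] at hab; exact y.ne_zero hab.symm
    refine ⟨_, ⟨a, Units.mk0 _ ha0, rfl, rfl⟩, _, ⟨b, Units.mk0 _ hb0, rfl, rfl⟩, ?_⟩
    have h1 : Units.mk0 _ ha0 = y * Units.mk0 _ hb0 := by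
      ext
      simp [← hab, hb0]
    have h2 : ν.val y = u := by simp [val, hy]
    rw [h1, val_mul, h2, add_sub_cancel_right]
  · intro t ht
    have h1 := Set.ncard_le_ncard (hsub t) (Finset.finite_toSet _)
    rw [Set.ncard_coe_finset, Fintype.card_piFinset] at h1
    have h2 : ∏ _i : Fin d, (Finset.Icc (-(⌊t / δ⌋₊ : ℤ)) ⌊t / δ⌋₊).card =
        (2 * ⌊t / δ⌋₊ + 1) ^ d := by
      rw [Finset.prod_const, Int.card_Icc, Finset.card_univ, Fintype.card_fin]
      congr 1
      omega
    rw [h2] at h1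
    have h3 : (countBelow ν.embedHom (ν.valueMonoid D) t : ℝ) ≤ (2 * (⌊t / δ⌋₊ : ℝ) + 1) ^ d := by
      exact_mod_cast h1
    refine h3.trans ?_
    rw [← mul_pow]
    refine pow_le_pow_left₀ (by positivity) ?_ d
    have h4 := Nat.floor_le (show 0 ≤ t / δ by positivity)
    calc _ ≤ 2 * (t / δ) + t := by linarith
      _ = _ := by ring

/-- Every element of the residue field of `V` is the residue of a fraction with one and the same
denominator `b` in `D`. -/
theorem IsOK.exists_denominator [IsFractionRing D F] (h : ν.IsOK D) : ∃ (b : D) (β : Fˣ), (β : F) = algebraMap D F b ∧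
    ∀ r : IsLocalRing.ResidueField ν.ring, ∃ (x : D) (v : ν.ring),
      algebraMap D F x = β * v ∧ IsLocalRing.residue ν.ring v = r := by
  classical
  let : Algebra D (IsLocalRing.ResidueField ν.ring) :=
    ((IsLocalRing.residue ν.ring).comp (ν.toRing D h.mem_ring)).toAlgebra
  have := h.isLocalHom
  have hfin : Module.Finite D (IsLocalRing.ResidueField ν.ring) :=
    h.finite_residue.comp (RingHom.Finite.of_surjective _ (IsLocalRing.residue_surjective (R := D)))
  obtain ⟨s, hs⟩ := hfin.fg_top
  choose l hl using IsLocalRing.residue_surjective (R := ν.ring)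
  -- The residue field of `V` is generated over `D` by finitely many residues; `b` clears the
  -- denominators of their lifts, and hence of all `D`-combinations of these lifts.
  obtain ⟨b, hb⟩ := IsLocalization.exist_integer_multiples_of_finset (nonZeroDivisors D)
    (s.image fun r => (l r : F))
  have hb0 : algebraMap D F b ≠ 0 := (IsLocalization.map_units F b).ne_zero
  refine ⟨b, Units.mk0 _ hb0, rfl, fun r => ?_⟩
  have hr : r ∈ Submodule.span D (s : Set (IsLocalRing.ResidueField ν.ring)) := hs ▸ trivial
  induction hr using Submodule.span_induction with
  | mem r hr =>
    obtain ⟨x, hx⟩ := hb (l r) (Finset.mem_image_of_mem _ hr)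
    exact ⟨x, l r, by rw [hx, Algebra.smul_def]; rfl, hl r⟩
  | zero => exact ⟨0, 0, by simp, by simp⟩
  | add r r' _ _ ih ih' =>
    obtain ⟨x, v, h1, h2⟩ := ih
    obtain ⟨x', v', h1', h2'⟩ := ih'
    exact ⟨x + x', v + v', by simp [h1, h1', mul_add], by simp [h2, h2']⟩
  | smul a r _ ih =>
    obtain ⟨x, v, h1, h2⟩ := ih
    refine ⟨a * x, ν.toRing D h.mem_ring a * v, ?_, ?_⟩
    · rw [map_mul, h1]
      show _ = _ * (algebraMap D F a * (v : F))
      ring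
    · rw [map_mul, h2, Algebra.smul_def]
      rfl

theorem IsOK.length_residueField_ne_top (h : ν.IsOK D) :
    letI : Algebra D (IsLocalRing.ResidueField ν.ring) :=
      ((IsLocalRing.residue ν.ring).comp (ν.toRing D h.mem_ring)).toAlgebra
    Module.length D (IsLocalRing.ResidueField ν.ring) ≠ ⊤ := by
  have := h.isLocalHom
  let : Algebra D (IsLocalRing.ResidueField ν.ring) :=
    ((IsLocalRing.residue ν.ring).comp (ν.toRing D h.mem_ring)).toAlgebra
  let : Algebra (IsLocalRing.ResidueField D) (IsLocalRing.ResidueField ν.ring) :=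
    (IsLocalRing.ResidueField.map (ν.toRing D h.mem_ring)).toAlgebra
  have : IsScalarTower D (IsLocalRing.ResidueField D) (IsLocalRing.ResidueField ν.ring) :=
    IsScalarTower.of_algebraMap_eq fun _ => rfl
  have : Module.Finite (IsLocalRing.ResidueField D) (IsLocalRing.ResidueField ν.ring) :=
    h.finite_residue
  show Module.length D (IsLocalRing.ResidueField ν.ring) ≠ ⊤
  rw [Module.length_eq_of_surjective (S := D) (R := IsLocalRing.ResidueField D)
    (IsLocalRing.residue_surjective)]
  exact Module.length_ne_top

/-- The graded pieces of an ideal with respect to the filtration by values have bounded length,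
and they have maximal length in all degrees that are shifts by a fixed vector of a value of the
ideal. -/
theorem IsOK.exists_graded_length [IsFractionRing D F] (h : ν.IsOK D) : ∃ (κ : ℕ) (γ : Fin d → ℤ),
    γ ∈ ν.valueMonoid D ∧ ∀ (M : Ideal D) (u : Fin d → ℤ),
      quotientLength (M ⊓ ν.levelIdeal h.mem_ring _ (isUpperSet_Ici (ν.embed u)))
        (M ⊓ ν.levelIdeal h.mem_ring _ (isUpperSet_Ioi (ν.embed u))) ≤ κ ∧
      (u ∉ ν.valueSet M →
        quotientLength (M ⊓ ν.levelIdeal h.mem_ring _ (isUpperSet_Ici (ν.embed u)))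
        (M ⊓ ν.levelIdeal h.mem_ring _ (isUpperSet_Ioi (ν.embed u))) = 0) ∧
      (∀ w ∈ ν.valueSet M, w + γ = u →
        quotientLength (M ⊓ ν.levelIdeal h.mem_ring _ (isUpperSet_Ici (ν.embed u)))
        (M ⊓ ν.levelIdeal h.mem_ring _ (isUpperSet_Ioi (ν.embed u))) = κ) := by
  let : Algebra D (IsLocalRing.ResidueField ν.ring) :=
    ((IsLocalRing.residue ν.ring).comp (ν.toRing D h.mem_ring)).toAlgebra
  obtain ⟨κ, hκ⟩ := ENat.ne_top_iff_exists.1 h.length_residueField_ne_top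
  obtain ⟨b, β, hβ, hden⟩ := h.exists_denominator
  -- `κ` is the length over `D` of the residue field of `V`, and `γ` is the value of the common
  -- denominator.
  refine ⟨κ, ν.val β, ⟨b, β, hβ, rfl⟩, fun M u => ?_⟩
  obtain ⟨y, hy⟩ := ν.toHom_surjective (Multiplicative.ofAdd u)
  replace hy : ν.val y = u := by simp [val, hy]
  have hmem : ∀ x : (M ⊓ ν.levelIdeal h.mem_ring _ (isUpperSet_Ici (ν.embed u)) : Ideal D),
      algebraMap D F x * (y⁻¹ : Fˣ) ∈ ν.ring := by
    intro x
    rw [mem_ring_iff]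
    intro z hz
    have h1 := ν.mem_levelIdeal.1 x.2.2 (z * y) (by simp [hz])
    rw [val_mul, embed_add, hy, Set.mem_Ici] at h1
    linarith
  -- Dividing by an element `y` of value `u` and taking residues embeds the graded piece of degree
  -- `u` in the residue field of `V`.
  let f : (M ⊓ ν.levelIdeal h.mem_ring _ (isUpperSet_Ici (ν.embed u)) : Ideal D) →ₗ[D]
      IsLocalRing.ResidueField ν.ring :=
    { toFun := fun x => IsLocalRing.residue ν.ring ⟨_, hmem x⟩
      map_add' := fun x x' => by
        rw [← map_add]
        exact congrArg _ (Subtype.ext (by simp [add_mul]))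
      map_smul' := fun r x => by
        rw [Algebra.smul_def]
        refine Eq.trans ?_ (map_mul (IsLocalRing.residue ν.ring) (ν.toRing D h.mem_ring r) _)
        refine congrArg _ (Subtype.ext ?_)
        show algebraMap D F (r * x) * _ = algebraMap D F r * (algebraMap D F x * _)
        rw [map_mul, mul_assoc] }
  have hker : ∀ x, f x = 0 ↔
      (x : D) ∈ M ⊓ ν.levelIdeal h.mem_ring _ (isUpperSet_Ioi (ν.embed u)) := by
    intro x
    refine (IsLocalRing.residue_eq_zero_iff _).trans ?_
    rw [mem_maximalIdeal_iff]
    constructor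
    · intro hx
      refine ⟨x.2.1, fun z hz => ?_⟩
      have h1 := hx (z * y⁻¹) (by simp [hz])
      rw [val_mul, embed_add, embed_val_inv, hy] at h1
      rw [Set.mem_Ioi]
      linarith
    · intro hx z hz
      have h1 := ν.mem_levelIdeal.1 hx.2 (z * y) (by simp [hz])
      rw [val_mul, embed_add, hy, Set.mem_Ioi] at h1
      linarith
  have hle : M ⊓ ν.levelIdeal h.mem_ring _ (isUpperSet_Ioi (ν.embed u)) ≤
      M ⊓ ν.levelIdeal h.mem_ring _ (isUpperSet_Ici (ν.embed u)) :=
    inf_le_inf_left _ fun x hx z hz => le_of_lt (Set.mem_Ioi.1 (hx z hz))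
  refine ⟨hκ ▸ quotientLength_le_of_ker f hker, fun hu => ?_, fun w hw hwu => ?_⟩
  · rw [le_antisymm hle, quotientLength_self]
    refine fun x hx => ⟨hx.1, fun z hz => Set.mem_Ioi.2 <|
      lt_of_le_of_ne (Set.mem_Ici.1 (hx.2 z hz)) fun heq => hu ?_⟩
    exact ⟨x, hx.1, z, hz, (ν.embedding_injective heq).symm⟩
  · rw [hκ]
    refine quotientLength_eq_of_ker f hker fun r => ?_
    obtain ⟨x₀, hx₀, y₀, hy₀, rfl⟩ := hw
    obtain ⟨ρ, rfl⟩ := IsLocalRing.residue_surjective r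
    have hunit : 0 = ν.embed (ν.val (y₀ * β * y⁻¹)) := by
      rw [val_mul, embed_add, embed_val_inv, hy, val_mul, hwu]
      ring
    have hε : ((y₀ * β * y⁻¹ : Fˣ) : F) ∈ ν.ring := by
      rw [mem_ring_iff]
      intro z hz
      rw [Units.ext hz, ← hunit]
    have hε' : (((y₀ * β * y⁻¹)⁻¹ : Fˣ) : F) ∈ ν.ring := by
      rw [mem_ring_iff]
      intro z hz
      rw [Units.ext hz, embed_val_inv, ← hunit, neg_zero]
    -- With `x₀ ∈ M` of value `w`, the element `ε = x₀ b / y` is a unit of `V`, since `w + γ = u`.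
    -- Choosing `x = b v` in `D` with `v` congruent to `ε⁻¹ρ` gives `x x₀ / y = ε v`, which has the
    -- residue of `ρ`.
    obtain ⟨x, v, hx, hv⟩ := hden (IsLocalRing.residue ν.ring (⟨_, hε'⟩ * ρ))
    have hxv : algebraMap D F (x * x₀) * (y⁻¹ : Fˣ) = ((y₀ * β * y⁻¹ : Fˣ) : F) * v := by
      rw [map_mul, hx, ← hy₀]
      push_cast
      ring
    refine ⟨⟨x * x₀, M.mul_mem_left _ hx₀, fun z hz => ?_⟩, ?_⟩
    · have h1 : (((z * y⁻¹ : Fˣ) : F)) ∈ ν.ring := by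
        have : (((z * y⁻¹ : Fˣ) : F)) = ((y₀ * β * y⁻¹ : Fˣ) : F) * v := by
          rw [← hxv, ← hz]
          simp
        rw [this]
        exact ν.ring.mul_mem _ _ hε v.2
      have h2 := ν.mem_ring_iff.1 h1 _ rfl
      rw [val_mul, embed_add, embed_val_inv, hy] at h2
      rw [Set.mem_Ici]
      linarith
    · show IsLocalRing.residue ν.ring ⟨algebraMap D F (x * x₀) * (y⁻¹ : Fˣ), _⟩ = _
      have h3 : (⟨algebraMap D F (x * x₀) * (y⁻¹ : Fˣ), hxv ▸ ν.ring.mul_mem _ _ hε v.2⟩ : ν.ring) =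
          ⟨_, hε⟩ * v := Subtype.ext hxv
      rw [h3, map_mul, hv, ← map_mul]
      congr 1
      rw [← mul_assoc]
      refine Eq.trans (congrArg (· * ρ) ?_) (one_mul ρ)
      exact Subtype.ext (y₀ * β * y⁻¹).mul_inv

end Full

end Relative

end LatticeValuation

/-! ### Lengths in an OK domain through counts of values -/

namespace LatticeValuation

variable {F : Type*} [Field F] {d : ℕ} {ν : LatticeValuation F d}
  {D : Type*} [CommRing D] [Algebra D F]

/-- Since no value of `D` lies strictly between `u` and level `t`, raising the shifted level from
that of `u` to `t` can add only the value `u - γ`. This is the inductive step of the lower length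
bound. -/
theorem countBelow_insert_le (M : Ideal D) (hfull : IsFullMonoid ν.embedHom (ν.valueMonoid D))
    {t : ℝ} {u : Fin d → ℤ} (hmax : ∀ v ∈ ν.valueMonoid D, ν.embed v < t → ν.embed v ≤ ν.embed u)
    {γ : Fin d → ℤ} (hγ : γ ∈ ν.valueMonoid D) :
    countBelow ν.embedHom (ν.valueSet M) (t - ν.embed γ) ≤
      countBelow ν.embedHom (ν.valueSet M) (ν.embed u - ν.embed γ) +
        {v ∈ ν.valueSet M | v + γ = u}.ncard := by
  have hfin : {v ∈ ν.valueSet M | v + γ = u}.Finite :=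
    (Set.finite_singleton (u - γ)).subset fun v hv => eq_sub_of_add_eq hv.2
  refine (Set.ncard_le_ncard ?_
    ((hfull.finite_of_subset (ν.valueSet_subset M) _).union hfin)).trans (Set.ncard_union_le _ _)
  rintro v ⟨hv, hvt⟩
  have hvt : ν.embed v < t - ν.embed γ := hvt
  rcases lt_or_ge (ν.embed v) (ν.embed u - ν.embed γ) with h | h
  · exact Or.inl ⟨hv, h⟩
  · refine Or.inr ⟨hv, ν.embedding_injective (le_antisymm ?_ ?_)⟩
    · exact hmax _ ((ν.valueMonoid D).add_mem (ν.valueSet_subset M hv) hγ)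
        (by rw [embed_add]; linarith)
    · show ν.embed u ≤ ν.embed (v + γ)
      rw [embed_add]
      linarith

variable [IsLocalRing D] [IsFractionRing D F]

/-- The colength of the elements of large value in an ideal is, up to a shift, a fixed multiple of
the number of small values of the ideal. -/
theorem IsOK.exists_length_bounds (h : ν.IsOK D) : ∃ (κ : ℕ) (K : ℝ), 0 ≤ K ∧
    ∀ (M : Ideal D) (t : ℝ),
      quotientLength M (M ⊓ ν.levelIdeal h.mem_ring _ (isUpperSet_Ici t)) ≤
        (κ * countBelow ν.embedHom (ν.valueSet M) t : ℕ) ∧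
      (κ * countBelow ν.embedHom (ν.valueSet M) (t - K) : ℕ) ≤
        quotientLength M (M ⊓ ν.levelIdeal h.mem_ring _ (isUpperSet_Ici t)) := by
  obtain ⟨κ, γ, hγ, hgr⟩ := h.exists_graded_length
  have hfull := h.isFullMonoid
  refine ⟨κ, ν.embed γ, hfull.nonneg γ hγ, fun M => ?_⟩
  have hK : 0 ≤ ν.embed γ := hfull.nonneg γ hγ
  -- The induction runs over the number of values of `D` below `t`. Removing the largest one, `u`,
  -- splits off the graded piece of degree `u`.
  suffices H : ∀ (n : ℕ) (t : ℝ), countBelow ν.embedHom (ν.valueMonoid D) t = n →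
      quotientLength M (M ⊓ ν.levelIdeal h.mem_ring _ (isUpperSet_Ici t)) ≤
        (κ * countBelow ν.embedHom (ν.valueSet M) t : ℕ) ∧
      (κ * countBelow ν.embedHom (ν.valueSet M) (t - ν.embed γ) : ℕ) ≤
        quotientLength M (M ⊓ ν.levelIdeal h.mem_ring _ (isUpperSet_Ici t)) from
    fun t => H _ t rfl
  intro n
  induction n using Nat.strong_induction_on with
  | _ n ih =>
  intro t hn
  rcases Set.eq_empty_or_nonempty
    {u ∈ (ν.valueMonoid D : Set (Fin d → ℤ)) | ν.embedHom u < t} with hempty | hne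
  · have hzero : ∀ s ≤ t, countBelow ν.embedHom (ν.valueSet M) s = 0 := by
      intro s hs
      have : {u ∈ ν.valueSet M | ν.embedHom u < s} = ∅ :=
        Set.eq_empty_of_subset_empty (hempty ▸ fun u hu =>
          ⟨ν.valueSet_subset M hu.1, hu.2.trans_le hs⟩)
      rw [countBelow, this, Set.ncard_empty]
    have htop : M ⊓ ν.levelIdeal h.mem_ring _ (isUpperSet_Ici t) = M := by
      refine inf_eq_left.2 fun x _ y hy => ?_
      by_contra hlt
      have : ν.val y ∈ (∅ : Set (Fin d → ℤ)) := hempty ▸ ⟨⟨x, y, hy, rfl⟩, not_le.1 hlt⟩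
      exact this
    rw [htop, quotientLength_self, hzero t le_rfl, hzero _ (by linarith)]
    simp
  · obtain ⟨u, ⟨hu, hut⟩, hmax'⟩ := Set.exists_max_image _ ν.embedHom (hfull.finite t) hne
    have hmax : ∀ v ∈ ν.valueMonoid D, ν.embed v < t → ν.embed v ≤ ν.embed u :=
      fun v hv hvt => hmax' v ⟨hv, hvt⟩
    have hut : ν.embed u < t := hut
    have hlt : countBelow ν.embedHom (ν.valueMonoid D) (ν.embed u) < n := by
      rw [← hn]
      refine Set.ncard_lt_ncard ⟨fun v hv => ⟨hv.1, lt_trans hv.2 hut⟩, fun hsub => ?_⟩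
        (hfull.finite t)
      exact lt_irrefl _ (hsub ⟨hu, hut⟩).2
    obtain ⟨ih1, ih2⟩ := ih _ hlt _ rfl
    have hlevel : ν.levelIdeal h.mem_ring _ (isUpperSet_Ici t) =
        ν.levelIdeal h.mem_ring _ (isUpperSet_Ioi (ν.embed u)) := by
      ext x
      refine forall_congr' fun y => forall_congr' fun hy => ?_
      rw [Set.mem_Ici, Set.mem_Ioi]
      refine ⟨hut.trans_le, fun hlt => ?_⟩
      by_contra! hlt'
      exact absurd (hmax _ ⟨x, y, hy, rfl⟩ hlt') (not_le.2 hlt)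
    have hadd := quotientLength_add
      (A := M) (B := M ⊓ ν.levelIdeal h.mem_ring _ (isUpperSet_Ici (ν.embed u)))
      (C := M ⊓ ν.levelIdeal h.mem_ring _ (isUpperSet_Ioi (ν.embed u)))
      (inf_le_inf_left _ fun x hx z hz => le_of_lt (Set.mem_Ioi.1 (hx z hz))) inf_le_left
    obtain ⟨g1, g2, g3⟩ := hgr M u
    rw [hlevel, hadd]
    constructor
    · by_cases hmem : u ∈ ν.valueSet M
      · have hcount : countBelow ν.embedHom (ν.valueSet M) (ν.embed u) + 1 ≤
            countBelow ν.embedHom (ν.valueSet M) t := by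
          refine Set.ncard_lt_ncard ⟨fun v hv => ⟨hv.1, lt_trans hv.2 hut⟩, fun hsub => ?_⟩
            (hfull.finite_of_subset (ν.valueSet_subset M) t)
          exact lt_irrefl _ (hsub ⟨hmem, hut⟩).2
        refine (add_le_add ih1 g1).trans ?_
        have := Nat.mul_le_mul_left κ hcount
        rw [mul_add, mul_one] at this
        exact_mod_cast this
      · rw [g2 hmem, add_zero]
        refine ih1.trans ?_
        exact_mod_cast Nat.mul_le_mul_left κ
          (hfull.countBelow_mono (ν.valueSet_subset M) hut.le)
    · have hcount := countBelow_insert_le M hfull hmax hγ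
      by_cases hex : ∃ w ∈ ν.valueSet M, w + γ = u
      · obtain ⟨w, hw, hwu⟩ := hex
        rw [g3 w hw hwu]
        have hone : {v ∈ ν.valueSet M | v + γ = u}.ncard ≤ 1 := by
          refine (Set.ncard_le_ncard (t := {w}) ?_).trans (Set.ncard_singleton w).le
          rintro v ⟨-, hv⟩
          exact add_right_cancel (hv.trans hwu.symm)
        refine le_trans ?_ (add_le_add_left ih2 _)
        have := Nat.mul_le_mul_left κ (hcount.trans (Nat.add_le_add_left hone _))
        rw [mul_add, mul_one] at this
        exact_mod_cast this
      · have hzero : {v ∈ ν.valueSet M | v + γ = u} = ∅ :=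
          Set.eq_empty_iff_forall_notMem.2 fun v hv => hex ⟨v, hv⟩
        rw [hzero, Set.ncard_empty, add_zero] at hcount
        refine le_trans ?_ (ih2.trans le_self_add)
        exact_mod_cast Nat.mul_le_mul_left κ hcount

theorem IsOK.exists_tendsto_level (h : ν.IsOK D) {p : ℕ} (hp : 1 < p) {α : ℝ} (hα : 1 ≤ α)
    (M : ℕ → Ideal D) (hM : ∀ e, ∀ x ∈ M e, x ^ p ∈ M (e + 1)) :
    (∀ e, quotientLength (M e)
      (M e ⊓ ν.levelIdeal h.mem_ring _ (isUpperSet_Ici ((p : ℝ) ^ e * α))) ≠ ⊤) ∧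
    ∃ L : ℝ, Tendsto (fun e : ℕ => ((quotientLength (M e)
      (M e ⊓ ν.levelIdeal h.mem_ring _ (isUpperSet_Ici ((p : ℝ) ^ e * α)))).toNat : ℝ) /
        ((p : ℝ) ^ e) ^ d) atTop (𝓝 L) := by
  obtain ⟨κ, K, hK, hb⟩ := h.exists_length_bounds
  have hne : ∀ e, quotientLength (M e)
      (M e ⊓ ν.levelIdeal h.mem_ring _ (isUpperSet_Ici ((p : ℝ) ^ e * α))) ≠ ⊤ :=
    fun e => ne_top_of_le_ne_top (ENat.natCast_ne_top _) (hb (M e) _).1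
  refine ⟨hne, ?_⟩
  obtain ⟨L, hL⟩ := h.isFullMonoid.exists_tendsto_countBelow hp (fun e => ν.valueSet (M e))
    (fun e => ν.valueSet_subset _) (fun e s hs u hu => ν.add_mem_valueSet hs hu)
    (fun e u hu => ν.nsmul_mem_valueSet (hM e) hu) hα
  have h1 := (hL K hK).const_mul (κ : ℝ)
  have h2 := (hL 0 le_rfl).const_mul (κ : ℝ)
  simp only [sub_zero] at h2
  refine ⟨κ * L, tendsto_of_tendsto_of_tendsto_of_le_of_le h1 h2 (fun e => ?_) fun e => ?_⟩
  · have := (hb (M e) ((p : ℝ) ^ e * α)).2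
    rw [← ENat.natCast_toNat (hne e), Nat.cast_le] at this
    simp only
    rw [← mul_div_assoc]
    refine div_le_div_of_nonneg_right ?_ (by positivity)
    exact_mod_cast this
  · have := (hb (M e) ((p : ℝ) ^ e * α)).1
    rw [← ENat.natCast_toNat (hne e), Nat.cast_le] at this
    simp only
    rw [← mul_div_assoc]
    refine div_le_div_of_nonneg_right ?_ (by positivity)
    exact_mod_cast this

/-- The case of OK domains. -/
theorem IsOK.exists_tendsto_quotientLength (h : ν.IsOK D) {p : ℕ} (hp : 1 < p)
    (I J : ℕ → Ideal D) (hI : ∀ e, ∀ x ∈ I e, x ^ p ∈ I (e + 1))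
    (hJ : ∀ e, ∀ x ∈ J e, x ^ p ∈ J (e + 1)) (hIJ : ∀ e, I e ≤ J e) (c : ℕ)
    (hc : ∀ e, J e ⊓ IsLocalRing.maximalIdeal D ^ (c * p ^ e) ≤ I e) :
    (∀ e, quotientLength (J e) (I e) ≠ ⊤) ∧
    ∃ L : ℝ, Tendsto (fun e : ℕ => ((quotientLength (J e) (I e)).toNat : ℝ) / ((p : ℝ) ^ e) ^ d)
      atTop (𝓝 L) := by
  obtain ⟨v, hv⟩ := h.exists_bound
  -- An element of level at least `qα` has level at least that of `(cq)v`, so by condition 4 it lies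
  -- in `𝔪^{cq}`. The maximum with `1` meets the requirement `1 ≤ α` of the counting argument.
  set α : ℝ := max 1 (c * ν.embed v)
  obtain ⟨hIt, LI, hLI⟩ := h.exists_tendsto_level hp (le_max_left _ _ : 1 ≤ α) I hI
  obtain ⟨hJt, LJ, hLJ⟩ := h.exists_tendsto_level hp (le_max_left _ _ : 1 ≤ α) J hJ
  have hadd : ∀ e, quotientLength (J e)
      (J e ⊓ ν.levelIdeal h.mem_ring _ (isUpperSet_Ici ((p : ℝ) ^ e * α))) =
      quotientLength (J e) (I e) + quotientLength (I e)
      (I e ⊓ ν.levelIdeal h.mem_ring _ (isUpperSet_Ici ((p : ℝ) ^ e * α))) := by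
    intro e
    have heq : J e ⊓ ν.levelIdeal h.mem_ring _ (isUpperSet_Ici ((p : ℝ) ^ e * α)) =
        I e ⊓ ν.levelIdeal h.mem_ring _ (isUpperSet_Ici ((p : ℝ) ^ e * α)) := by
      refine le_antisymm (fun x hx => ⟨hc e ⟨hx.1, hv _ _ fun y hy => ?_⟩, hx.2⟩)
        (inf_le_inf_right _ (hIJ e))
      refine le_trans ?_ (hx.2 y hy)
      rw [embed_nsmul]
      have h1 : c * ν.embed v ≤ α := le_max_right _ _
      push_cast
      calc _ = (p : ℝ) ^ e * (c * ν.embed v) := by ring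
        _ ≤ _ := by gcongr
    rw [heq]
    exact quotientLength_add inf_le_left (hIJ e)
  have hne : ∀ e, quotientLength (J e) (I e) ≠ ⊤ := fun e =>
    ne_top_of_le_ne_top (hJt e) (hadd e ▸ le_self_add)
  refine ⟨hne, LJ - LI, (hLJ.sub hLI).congr fun e => ?_⟩
  rw [hadd e, ENat.toNat_add (hne e) (hIt e), ← sub_div]
  push_cast
  rw [add_sub_cancel_right]

end LatticeValuation

/-! ### From OK domains to reduced local rings -/

theorem exists_tendsto_div_pow_of_le {p d' d : ℕ} (hp : 1 < p) (hd : d' ≤ d) {f : ℕ → ℝ}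
    (hf : ∃ L : ℝ, Tendsto (fun e => f e / ((p : ℝ) ^ e) ^ d') atTop (𝓝 L)) :
    ∃ L : ℝ, Tendsto (fun e => f e / ((p : ℝ) ^ e) ^ d) atTop (𝓝 L) := by
  obtain ⟨L, hL⟩ := hf
  rcases hd.eq_or_lt with rfl | hlt
  · exact ⟨L, hL⟩
  have hp' : (1 : ℝ) < p := by exact_mod_cast hp
  have h0 : Tendsto (fun e : ℕ => (((p : ℝ) ^ e) ^ (d - d'))⁻¹) atTop (𝓝 0) :=
    tendsto_inv_atTop_zero.comp ((tendsto_pow_atTop (by omega)).comp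
      (tendsto_pow_atTop_atTop_of_one_lt hp'))
  refine ⟨L * 0, (hL.mul h0).congr fun e => ?_⟩
  obtain ⟨k, rfl⟩ := Nat.exists_eq_add_of_le hd
  rw [Nat.add_sub_cancel_left, ← div_eq_mul_inv, div_div, pow_add]

section LocalRing

open IsLocalRing

variable {R : Type*} [CommRing R] [IsLocalRing R] [IsNoetherianRing R]

/-- A linear form of the Artin–Rees lemma in a quotient of a local ring. -/
theorem exists_inf_pow_maximalIdeal_le (K P : Ideal R) [IsLocalRing (R ⧸ P)] :
    ∃ k : ℕ, ∀ n, K.map (Ideal.Quotient.mk P) ⊓ maximalIdeal (R ⧸ P) ^ (n + k) ≤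
      (maximalIdeal R ^ n * K).map (Ideal.Quotient.mk P) := by
  obtain ⟨k, hk⟩ := (maximalIdeal (R ⧸ P)).exists_pow_inf_eq_pow_smul
    (K.map (Ideal.Quotient.mk P))
  have hm : maximalIdeal (R ⧸ P) ≤ (maximalIdeal R).map (Ideal.Quotient.mk P) := by
    intro y hy
    obtain ⟨x, rfl⟩ := Ideal.Quotient.mk_surjective y
    refine Ideal.mem_map_of_mem _ ((mem_maximalIdeal _).2 fun hx => ?_)
    exact (mem_maximalIdeal _).1 hy (hx.map _)
  refine ⟨k, fun n => ?_⟩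
  have h1 := hk (n + k) (Nat.le_add_left _ _)
  rw [smul_eq_mul, Ideal.mul_top, Nat.add_sub_cancel] at h1
  rw [inf_comm, h1, Ideal.map_mul, Ideal.map_pow]
  exact Ideal.mul_mono (Ideal.pow_right_mono hm n) inf_le_right

/-- The isomorphism theorems and the modular law identify the quotient with `KD/(A_q ∩ K)D` for `D =
R/P`. Constant families are closed under `p`-th powers, so the result for OK domains applies to
`(A_q ∩ K)D` inside the constant family `KD`. -/
theorem exists_tendsto_quotientLength_inf {p : ℕ} (hp : 1 < p) {d : ℕ}
    (hd : ringKrullDim R = d) {P : Ideal R} (hP : IsOKDomain (R ⧸ P)) (K : Ideal R)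
    (A : ℕ → Ideal R) (hA : ∀ e, ∀ x ∈ A e, x ^ p ∈ A (e + 1)) (c : ℕ)
    (hc : ∀ e, maximalIdeal R ^ (c * p ^ e) ≤ A e) :
    (∀ e, quotientLength (A e ⊔ K) (A e ⊔ P ⊓ K) ≠ ⊤) ∧
    ∃ L : ℝ, Tendsto (fun e : ℕ => ((quotientLength (A e ⊔ K) (A e ⊔ P ⊓ K)).toNat : ℝ) /
      ((p : ℝ) ^ e) ^ d) atTop (𝓝 L) := by
  obtain ⟨_, _, _, d', hd', ν, hν⟩ := hP
  -- A component may have smaller dimension; it then contributes `0` to the limit.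
  have hdd : d' ≤ d := by
    have := ringKrullDim_quotient_le P
    rw [hd, hd'] at this
    exact_mod_cast this
  have hsurj : Function.Surjective (algebraMap R (R ⧸ P)) := Ideal.Quotient.mk_surjective
  have heq : ∀ e, quotientLength (A e ⊔ K) (A e ⊔ P ⊓ K) =
      quotientLength (K.map (Ideal.Quotient.mk P)) ((A e ⊓ K).map (Ideal.Quotient.mk P)) := by
    intro e
    have h1 : A e ⊔ K = K ⊔ (A e ⊔ P ⊓ K) :=
      le_antisymm (sup_le (le_sup_of_le_right le_sup_left) le_sup_left)
        (sup_le le_sup_right (sup_le le_sup_left (inf_le_right.trans le_sup_right)))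
    have h2 : K ⊓ (A e ⊔ P ⊓ K) = A e ⊓ K ⊔ K ⊓ P := by
      rw [inf_comm, sup_comm, sup_inf_assoc_of_le _ inf_le_right, sup_comm, inf_comm P]
    rw [h1, quotientLength_sup, h2]
    have h3 := quotientLength_map hsurj (inf_le_right : A e ⊓ K ≤ K)
    rw [Ideal.Quotient.algebraMap_eq, Ideal.mk_ker] at h3
    exact h3.symm
  simp only [heq]
  obtain ⟨k, hk⟩ := exists_inf_pow_maximalIdeal_le K P
  obtain ⟨h1, h2⟩ := hν.exists_tendsto_quotientLength hp
    (fun e => (A e ⊓ K).map (Ideal.Quotient.mk P)) (fun _ => K.map (Ideal.Quotient.mk P))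
    (fun e x hx => by
      obtain ⟨y, hy, rfl⟩ := (Ideal.mem_map_iff_of_surjective _ hsurj).1 hx
      rw [← map_pow]
      exact Ideal.mem_map_of_mem _ ⟨hA e y hy.1, K.pow_mem_of_mem hy.2 p (by omega)⟩)
    (fun e x hx => Ideal.pow_mem_of_mem _ hx p (by omega))
    (fun e => Ideal.map_mono inf_le_right) (c + k) (fun e => by
      -- The additive Artin–Rees constant `k` is absorbed by replacing `c` with `c + k`, as `1 ≤
      -- p^e`.
      have hle : c * p ^ e + k ≤ (c + k) * p ^ e := by
        have := Nat.le_mul_of_pos_right k (pow_pos (by omega : 0 < p) e)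
        rw [add_mul]
        omega
      refine (inf_le_inf_left _ (Ideal.pow_le_pow_right hle)).trans ((hk _).trans ?_)
      exact Ideal.map_mono (le_inf (Ideal.mul_le_left.trans (hc e)) Ideal.mul_le_right))
  exact ⟨h1, exists_tendsto_div_pow_of_le hp hdd h2⟩

theorem exists_tendsto_colength {p : ℕ} (hp : 1 < p) {d : ℕ} (hd : ringKrullDim R = d)
    (s : Finset (Ideal R)) (hs : ∀ P ∈ s, IsOKDomain (R ⧸ P)) (A : ℕ → Ideal R)
    (hA : ∀ e, ∀ x ∈ A e, x ^ p ∈ A (e + 1)) (c : ℕ)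
    (hc : ∀ e, maximalIdeal R ^ (c * p ^ e) ≤ A e) :
    (∀ e, quotientLength ⊤ (A e ⊔ s.inf id) ≠ ⊤) ∧
    ∃ L : ℝ, Tendsto (fun e : ℕ => ((quotientLength ⊤ (A e ⊔ s.inf id)).toNat : ℝ) /
      ((p : ℝ) ^ e) ^ d) atTop (𝓝 L) := by
  classical
  induction s using Finset.induction_on with
  | empty =>
    simp only [Finset.inf_empty, sup_top_eq, quotientLength_self]
    exact ⟨by simp, 0, by simp⟩
  | insert P s _ ih =>
    obtain ⟨ih1, L, hL⟩ := ih fun Q hQ => hs Q (Finset.mem_insert_of_mem hQ)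
    obtain ⟨h1, L', hL'⟩ := exists_tendsto_quotientLength_inf hp hd
      (hs P (Finset.mem_insert_self P s)) (s.inf id) A hA c hc
    have hadd : ∀ e, quotientLength ⊤ (A e ⊔ (insert P s).inf id) =
        quotientLength ⊤ (A e ⊔ s.inf id) +
          quotientLength (A e ⊔ s.inf id) (A e ⊔ P ⊓ s.inf id) := by
      intro e
      rw [Finset.inf_insert]
      exact quotientLength_add (sup_le_sup_left inf_le_right _) le_top
    simp only [hadd]
    refine ⟨fun e => WithTop.add_ne_top.2 ⟨ih1 e, h1 e⟩, L + L', (hL.add hL').congr fun e => ?_⟩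
    rw [ENat.toNat_add (ih1 e) (h1 e), Nat.cast_add, add_div]

theorem exists_tendsto_colength_of_isReduced [IsReduced R] {p : ℕ} (hp : 1 < p) {d : ℕ}
    (hd : ringKrullDim R = d) (hOK : ∀ P ∈ minimalPrimes R, IsOKDomain (R ⧸ P)) (A : ℕ → Ideal R)
    (hA : ∀ e, ∀ x ∈ A e, x ^ p ∈ A (e + 1)) (c : ℕ)
    (hc : ∀ e, maximalIdeal R ^ (c * p ^ e) ≤ A e) :
    (∀ e, quotientLength ⊤ (A e) ≠ ⊤) ∧
    ∃ L : ℝ, Tendsto (fun e : ℕ => ((quotientLength ⊤ (A e)).toNat : ℝ) /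
      ((p : ℝ) ^ e) ^ d) atTop (𝓝 L) := by
  have hfin := minimalPrimes.finite_of_isNoetherianRing R
  have hinf : hfin.toFinset.inf id = ⊥ := by
    rw [Finset.inf_id_eq_sInf, hfin.coe_toFinset]
    refine (Ideal.sInf_minimalPrimes (I := (⊥ : Ideal R))).trans ?_
    exact nilradical_eq_zero R
  have := exists_tendsto_colength hp hd hfin.toFinset
    (fun P hP => hOK P (hfin.mem_toFinset.1 hP)) A hA c hc
  simpa only [hinf, sup_bot_eq] using this

end LocalRing

/-! ### Reduction of the theorem to colengths -/

theorem IsPFamily.pow_mem {R : Type*} [CommRing R] {p : ℕ} {I : ℕ → Ideal R}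
    (hI : IsPFamily p I) {e : ℕ} {x : R} (hx : x ∈ I e) : x ^ p ∈ I (e + 1) :=
  hI e (Ideal.subset_span ⟨x, hx, rfl⟩)

/-- Additivity of Frobenius is what lets the powers of `m` be added to the family. It is the only
use of characteristic `p`: the remaining argument needs just `1 < p` and closure under `p`-th powers
of elements. -/
theorem IsPFamily.pow_mem_sup_pow {R : Type*} [CommRing R] {p : ℕ} [Fact p.Prime] [CharP R p]
    {I : ℕ → Ideal R} (hI : IsPFamily p I) (m : Ideal R) (c e : ℕ) {x : R}
    (hx : x ∈ I e ⊔ m ^ (c * p ^ e)) : x ^ p ∈ I (e + 1) ⊔ m ^ (c * p ^ (e + 1)) := by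
  obtain ⟨a, ha, b, hb, rfl⟩ := Submodule.mem_sup.1 hx
  rw [add_pow_char]
  refine Submodule.add_mem_sup (hI.pow_mem ha) ?_
  rw [pow_succ, ← mul_assoc, pow_mul]
  exact Ideal.pow_mem_pow hb p

/-- By the modular law `J ∩ (I + m) = I + (J ∩ m)`, and `J ∩ m = I ∩ m` already lies in `I`. -/
theorem quotientLength_sup_sup {R : Type*} [CommRing R] {I J m : Ideal R} (hIJ : I ≤ J)
    (h : m ⊓ I = m ⊓ J) : quotientLength (J ⊔ m) (I ⊔ m) = quotientLength J I := by
  have h1 : J ⊔ m = J ⊔ (I ⊔ m) := by rw [← sup_assoc, sup_eq_left.2 hIJ]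
  have h2 : J ⊓ (I ⊔ m) = I := by
    rw [inf_comm, sup_inf_assoc_of_le _ hIJ, ← h, sup_eq_left.2 inf_le_right]
  rw [h1, quotientLength_sup, h2]

theorem mainTheorem4 {R : Type*} [CommRing R] [IsLocalRing R] [IsNoetherianRing R] [IsReduced R]
    (p : ℕ) [Fact p.Prime] [CharP R p]
    (d : ℕ) (hd : ringKrullDim R = d)
    (hOK : ∀ P ∈ minimalPrimes R, IsOKDomain (R ⧸ P))
    (I J : ℕ → Ideal R) (hI : IsPFamily p I) (hJ : IsPFamily p J)
    (hIJ : ∀ e : ℕ, I e ≤ J e)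
    (c : ℕ) (hc : 0 < c)
    (hcap : ∀ e : ℕ, IsLocalRing.maximalIdeal R ^ (c * p ^ e) ⊓ I e =
      IsLocalRing.maximalIdeal R ^ (c * p ^ e) ⊓ J e) :
    (∀ e : ℕ, quotientLength (J e) (I e) ≠ ⊤) ∧
      ∃ L : ℝ, Tendsto
        (fun e : ℕ => ((quotientLength (J e) (I e)).toNat : ℝ) / ((p : ℝ) ^ e) ^ d)
        atTop (𝓝 L) := by
  have hp : 1 < p := (Fact.out : p.Prime).one_lt
  obtain ⟨hI1, LI, hLI⟩ := exists_tendsto_colength_of_isReduced hp hd hOK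
    (fun e => I e ⊔ IsLocalRing.maximalIdeal R ^ (c * p ^ e))
    (fun e x hx => hI.pow_mem_sup_pow _ c e hx) c fun e => le_sup_right
  obtain ⟨hJ1, LJ, hLJ⟩ := exists_tendsto_colength_of_isReduced hp hd hOK
    (fun e => J e ⊔ IsLocalRing.maximalIdeal R ^ (c * p ^ e))
    (fun e x hx => hJ.pow_mem_sup_pow _ c e hx) c fun e => le_sup_right
  have hadd : ∀ e, quotientLength ⊤ (I e ⊔ IsLocalRing.maximalIdeal R ^ (c * p ^ e)) =
      quotientLength ⊤ (J e ⊔ IsLocalRing.maximalIdeal R ^ (c * p ^ e)) +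
        quotientLength (J e) (I e) := by
    intro e
    rw [← quotientLength_sup_sup (hIJ e) (hcap e)]
    exact quotientLength_add (sup_le_sup_right (hIJ e) _) le_top
  have hne : ∀ e, quotientLength (J e) (I e) ≠ ⊤ := fun e =>
    ne_top_of_le_ne_top (hI1 e) (hadd e ▸ le_add_self)
  refine ⟨hne, LI - LJ, (hLI.sub hLJ).congr fun e => ?_⟩
  rw [hadd e, ENat.toNat_add (hJ1 e) (hne e), ← sub_div]
  push_cast
  rw [add_sub_cancel_left]
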